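/- \textbf{Conventions.} Fix a first-order signature; $n\ge 0$ denotes the arity of a symbol. For a set $X$, $\beta X$ is the space of ultrafilters over $X$ with basic open sets $\{\mathfrak u: A\in\mathfrak u\}$, $A\subseteq X$; a point $a\in X$ is identified with the principal ultrafilter it generates. For $\mathfrak u\in\beta X$, $(\forall^{\mathfrak u}x)\,\varphi(x)$ means $\{x:\varphi(x)\}\in\mathfrak u$. For a map $h:X\to Y$ into a compact Hausdorff space, $\widetilde h:\beta X\to Y$ is its continuous extension. For $F:X^n\to X$ and $R\subseteq X^n$ let $$\widetilde F(\mathfrak u_1,\dots,\mathfrak u_n)=\{A\subseteq X:(\forall^{\mathfrak u_1}x_1)\dots(\forall^{\mathfrak u_n}x_n)\,F(x_1,\dots,x_n)\in A\},$$ $$\widetilde R=\{(\mathfrak u_1,\dots,\mathfrak u_n):(\forall^{\mathfrak u_1}x_1)\dots(\forall^{\mathfrak u_n}x_n)\,(x_1,\dots,x_n)\in R\},$$ $$R^*=\{(\mathfrak u_1,\dots,\mathfrak u_n):(\forall A_1\in\mathfrak u_1)\dots(\forall A_n\in\mathfrak u_n)\;(A_1\times\dots\times A_n)\cap R\neq\emptyset\}.$$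 For an ordinary model $\mathfrak A=(X,F,\dots,R,\dots)$ put $\widetilde{\mathfrak A}=(\beta X,\widetilde F,\dots,\widetilde R,\dots)$ and $\mathfrak A^*=(\beta X,\widetilde F,\dots,R^*,\dots)$. A \emph{narrow-sense generalized model} $\mathfrak B=(\beta X,\mathfrak f,\dots,\mathfrak r,\dots)$ interprets $n$-ary functional and predicate symbols by ultrafilters $\mathfrak f\in\beta(X^{X^n})$ and $\mathfrak r\in\beta\,\mathcal P(X^n)$. It is \emph{pseudo-principal on functional symbols} if for every such $\mathfrak f$ and all $a_1,\dots,a_n\in X$ the ultrafilter $\{A\subseteq X:(\forall^{\mathfrak f}\varphi)\,\varphi(a_1,\dots,a_n)\in A\}$ is principal. Its \emph{principal submodel} is then the ordinary model on $X$ in which the operation interpreting the symbol sends $(a_1,\dots,a_n)$ to the point generating this ultrafilter, and a predicate symbol with ultrafilter $\mathfrak r$ holds at $(a_1,\dots,a_n)$ iff $(\forall^{\mathfrak r}R)\,(a_1,\dots,a_n)\in R$. A \emph{wide-sense generalized model} with universe $Z$ interprets $n$-ary symbols by ultrafilters over $Z^{Z^n}$ and over $\mathcal P(Z^n)$. The wide-sense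 model $i(\mathfrak B)$ on $\beta X$ interprets the symbols by the images of the ultrafilters $\mathfrak f,\mathfrak r$ of $\mathfrak B$ under the maps $\varphi\mapsto\widetilde\varphi$ and $R\mapsto\widetilde R$. An ordinary model is regarded as a wide-sense model by interpreting each symbol by the principal ultrafilter given by its interpretation; its limit is the model itself. For $D\subseteq Z$, $Z$ a topological space, an operation $F:Z^n\to Z$ is \emph{right continuous w.r.t.\ $D$} if for all $1\le k\le n$, $a_1,\dots,a_{k-1}\in D$ and $x_{k+1},\dots,x_n\in Z$ the map $x\mapsto F(a_1,\dots,a_{k-1},x,x_{k+1},\dots,x_n)$ is continuous. A relation $S\subseteq Z^n$ is \emph{right closed} (\emph{right clopen}) \emph{w.r.t.\ $D$} if all sets $\{x:(a_1,\dots,a_{k-1},x,x_{k+1},\dots,x_n)\in S\}$, with the same parameters, are closed (clopen). If $C$ is a subset of a topological space $T$, an ultrafilter over $T$ \emph{has the limit $p$ in $C$} if $p$ is the only point of $C$ to which it converges. Limits of a wide-sense model are formed symbol by symbol and are ordinary models; a map is a \emph{homomorphism} $\mathfrak U\to\mathfrak V$ of wide-sense models if both limits exist and it is a homomorphism $\lim\mathfrak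 U\to\lim\mathfrak V$ of ordinary models (commuting with operations and sending related tuples to related tuples). For $i(\mathfrak B)$ the limits are taken in the sets of operations right continuous, and of relations right clopen, w.r.t.\ $X$ on $\beta X$, in the topologies of pointwise convergence on $X^n$ (relations being identified with characteristic functions into the discrete space $\{0,1\}$). \textbf{Theorem.} Let $\mathfrak U=i(\mathfrak B)$, where $\mathfrak B$ is a narrow-sense generalized model with universe $\beta X$ that is pseudo-principal on functional symbols, and let $\mathfrak A$ be its principal submodel. Let $Y$ be a compact Hausdorff space, $h:X\to Y$ a map, and let $\mathfrak V$ be a wide-sense generalized model with universe $Y$ in the same signature, where each $Y^{Y^n}$ and each $\mathcal P(Y^n)$ carries some fixed topology. Suppose that the ultrafilter interpreting each $n$-ary functional symbol in $\mathfrak V$ has a limit in the set of $n$-ary operations on $Y$ right continuous w.r.t.\ $h``X=\{h(x):x\in X\}$, and that the ultrafilter interpreting each $n$-ary predicate symbol in $\mathfrak V$ has a limit in the set of $n$-ary relations on $Y$ right closed w.r.t.\ $h``X$; $\lim\mathfrak V$ is formed by these limits. Then the following are equivalent: \begin{enumerate} \item[(i)] $h$ is a homomorphism of $\mathfrak A$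 into $\mathfrak V$; \item[(ii)] $\widetilde h$ is a homomorphism of $\mathfrak U$ into $\mathfrak V$; \item[(iii)] $\widetilde h$ is a homomorphism of $\widetilde{\mathfrak A}$ into $\mathfrak V$. \end{enumerate} If, moreover, the ultrafilter interpreting each $n$-ary predicate symbol in $\mathfrak V$ has a limit in the set of subsets of $Y^n$ closed in the product topology, then each of (i)--(iii) is also equivalent to \begin{enumerate} \item[(iv)] $\widetilde h$ is a homomorphism of $\mathfrak A^*$ into $\mathfrak V$. \end{enumerate} -/

import Mathlib

universe u v w w'

/-!
The space of ultrafilters over a set `X` is Mathlib's `Ultrafilter X` with its standard topology,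
whose basic open sets are `{u | A ∈ u}`; a point `a` of `X` is identified with the principal
ultrafilter `pure a`.  The continuous extension of a map `h : X → Y` into a compact Hausdorff space
is `Ultrafilter.extend h`.  Ordinary models are Mathlib's `L.Structure X`.
-/

namespace UltraModel

/-! ### Ultrafilter extensions of operations, relations and ordinary models -/

section Extensions

variable {X : Type u}

/-- The iterated product of a finite sequence of ultrafilters: the extension to ultrafilters of the
operation of taking `n`-tuples.  A set `A` belongs to it iff
`(∀^{u 0} x₀) … (∀^{u (n-1)} xₙ₋₁), (x₀, …, xₙ₋₁) ∈ A`. -/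
def tensor : {n : ℕ} → (Fin n → Ultrafilter X) → Ultrafilter (Fin n → X)
  | 0, _ => pure Fin.elim0
  | _ + 1, u => (u 0).bind fun x => (tensor (Fin.tail u)).map (Fin.cons x)

theorem mem_tensor_zero (u : Fin 0 → Ultrafilter X) (A : Set (Fin 0 → X)) :
    A ∈ tensor u ↔ Fin.elim0 ∈ A := Iff.rfl

theorem mem_tensor_succ {n : ℕ} (u : Fin (n + 1) → Ultrafilter X) (A : Set (Fin (n + 1) → X)) :
    A ∈ tensor u ↔ ∀ᶠ x in (u 0 : Filter X),
      ∀ᶠ y in (tensor (Fin.tail u) : Filter (Fin n → X)),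
        (Fin.cons x y : Fin (n + 1) → X) ∈ A := Iff.rfl

/-- The ultrafilter extension of an `n`-ary operation:
`A ∈ tildeOp F u` iff `(∀^{u 0} x₀) … (∀^{u (n-1)} xₙ₋₁), F (x₀, …, xₙ₋₁) ∈ A`. -/
def tildeOp {n : ℕ} (F : (Fin n → X) → X) (u : Fin n → Ultrafilter X) : Ultrafilter X :=
  (tensor u).map F

/-- The smaller ultrafilter extension of an `n`-ary relation:
`u ∈ tildeRel R` iff `(∀^{u 0} x₀) … (∀^{u (n-1)} xₙ₋₁), (x₀, …, xₙ₋₁) ∈ R`. -/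
def tildeRel {n : ℕ} (R : Set (Fin n → X)) : Set (Fin n → Ultrafilter X) :=
  {u | R ∈ tensor u}

/-- The larger ultrafilter extension of an `n`-ary relation. -/
def starRel {n : ℕ} (R : Set (Fin n → X)) : Set (Fin n → Ultrafilter X) :=
  {u | ∀ A : Fin n → Set X, (∀ k, A k ∈ u k) → ∃ x : Fin n → X, (∀ k, x k ∈ A k) ∧ x ∈ R}

variable {L : FirstOrder.Language.{w, w'}}

/-- The extension of an ordinary model with universe `X` by the smaller extensions of relations. -/
def tildeModel (𝔄 : L.Structure X) : L.Structure (Ultrafilter X) where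
  funMap f := tildeOp fun x => 𝔄.funMap f x
  RelMap R u := u ∈ tildeRel {x | 𝔄.RelMap R x}

/-- The extension of an ordinary model with universe `X` by the larger extensions of relations. -/
def starModel (𝔄 : L.Structure X) : L.Structure (Ultrafilter X) where
  funMap f := tildeOp fun x => 𝔄.funMap f x
  RelMap R u := u ∈ starRel {x | 𝔄.RelMap R x}

end Extensions

/-! ### Generalized models in the narrow sense -/

/-- A generalized model in the narrow sense, with universe `Ultrafilter X`: symbols are interpreted
by ultrafilters over the sets of operations and of relations on `X`. -/
structure NarrowModel (L : FirstOrder.Language.{w, w'}) (X : Type u) where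
  op : {n : ℕ} → L.Functions n → Ultrafilter ((Fin n → X) → X)
  rel : {n : ℕ} → L.Relations n → Ultrafilter (Set (Fin n → X))

section Narrow

variable {X : Type u}

/-- The ultrafilter extension of the application map `(x₀, …, xₙ₋₁, φ) ↦ φ (x₀, …, xₙ₋₁)`:
`A ∈ appTilde u 𝔣` iff `(∀^{u 0} x₀) … (∀^{u (n-1)} xₙ₋₁) (∀^𝔣 φ), φ (x₀, …, xₙ₋₁) ∈ A`. -/
def appTilde {n : ℕ} (u : Fin n → Ultrafilter X) (𝔣 : Ultrafilter ((Fin n → X) → X)) :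
    Ultrafilter X :=
  (tensor u).bind fun x => 𝔣.map fun φ => φ x

/-- The (smaller) ultrafilter extension of the membership predicate `(x₀, …, xₙ₋₁) ∈ R`:
it holds iff `(∀^{u 0} x₀) … (∀^{u (n-1)} xₙ₋₁) (∀^𝔯 R), (x₀, …, xₙ₋₁) ∈ R`. -/
def inTilde {n : ℕ} (u : Fin n → Ultrafilter X) (𝔯 : Ultrafilter (Set (Fin n → X))) : Prop :=
  ∀ᶠ x in (tensor u : Filter (Fin n → X)), ∀ᶠ R in (𝔯 : Filter (Set (Fin n → X))), x ∈ R

/-- An ultrafilter over the set of `n`-ary operations is pseudo-principal if the extended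
application map takes it, together with principal ultrafilters, to principal ultrafilters. -/
def IsPseudoPrincipal {n : ℕ} (𝔣 : Ultrafilter ((Fin n → X) → X)) : Prop :=
  ∀ a : Fin n → X, ∃ b : X, appTilde (fun k => pure (a k)) 𝔣 = pure b

variable {L : FirstOrder.Language.{w, w'}}

/-- The interpretation is pseudo-principal on functional symbols. -/
def NarrowModel.PseudoPrincipal (𝔅 : NarrowModel L X) : Prop :=
  ∀ {n : ℕ} (f : L.Functions n), IsPseudoPrincipal (𝔅.op f)

/-- The principal submodel, whose universe is the set of principal ultrafilters, identified
with `X`. -/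
noncomputable def NarrowModel.principalSubmodel (𝔅 : NarrowModel L X) (h𝔅 : 𝔅.PseudoPrincipal) :
    L.Structure X where
  funMap f a := (h𝔅 f a).choose
  RelMap R a := inTilde (fun k => pure (a k)) (𝔅.rel R)

theorem NarrowModel.pure_funMap_principalSubmodel (𝔅 : NarrowModel L X) (h𝔅 : 𝔅.PseudoPrincipal)
    {n : ℕ} (f : L.Functions n) (a : Fin n → X) :
    pure ((𝔅.principalSubmodel h𝔅).funMap f a) = appTilde (fun k => pure (a k)) (𝔅.op f) :=
  (h𝔅 f a).choose_spec.symm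

end Narrow

/-! ### Generalized models in the wide sense -/

/-- A generalized model in the wide sense, with universe `Z`: symbols are interpreted by
ultrafilters over the sets of operations and of relations on `Z` itself. -/
structure WideModel (L : FirstOrder.Language.{w, w'}) (Z : Type u) where
  op : {n : ℕ} → L.Functions n → Ultrafilter ((Fin n → Z) → Z)
  rel : {n : ℕ} → L.Relations n → Ultrafilter (Set (Fin n → Z))

/-- The identification map `i` on models.  The ultrafilter `i(𝔣)` is generated by the sets
`{φ̃ : φ ∈ A}` with `A ∈ 𝔣`, and `i(𝔯)` by the sets `{R̃ : R ∈ A}` with `A ∈ 𝔯`. -/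
def NarrowModel.toWide {L : FirstOrder.Language.{w, w'}} {X : Type u} (𝔅 : NarrowModel L X) :
    WideModel L (Ultrafilter X) where
  op f := (𝔅.op f).map tildeOp
  rel R := (𝔅.rel R).map tildeRel

/-- An ordinary model as a generalized model in the wide sense with principal interpretation. -/
def WideModel.ofModel {L : FirstOrder.Language.{w, w'}} {Z : Type u} (𝔄 : L.Structure Z) : WideModel L Z where
  op f := pure fun x => 𝔄.funMap f x
  rel R := pure {x | 𝔄.RelMap R x}

/-- `a` is the limit of the ultrafilter `𝔲` in the set `C` of points of the topological space
`(α, t)`: the only point of `C` to which `𝔲` converges. -/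
def IsLimitIn {α : Type u} (t : TopologicalSpace α) (C : Set α) (𝔲 : Ultrafilter α) (a : α) :
    Prop :=
  a ∈ C ∧ (𝔲 : Filter α) ≤ @nhds α t a ∧ ∀ b ∈ C, (𝔲 : Filter α) ≤ @nhds α t b → b = a

/-- The data with respect to which limits of generalized models with universe `Z` are taken:
topologies on the sets of `n`-ary operations and of `n`-ary relations on `Z`, and the sets of
operations and of relations in which the limits are taken. -/
structure LimitSpaces (Z : Type u) where
  opTop : (n : ℕ) → TopologicalSpace ((Fin n → Z) → Z)
  relTop : (n : ℕ) → TopologicalSpace (Set (Fin n → Z))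
  ops : (n : ℕ) → Set ((Fin n → Z) → Z)
  rels : (n : ℕ) → Set (Set (Fin n → Z))

/-- The ordinary model `𝔐` is the limit of the generalized model `𝔘`. -/
def WideModel.IsLimit {L : FirstOrder.Language.{w, w'}} {Z : Type u} (𝔘 : WideModel L Z) (T : LimitSpaces Z)
    (𝔐 : L.Structure Z) : Prop :=
  (∀ (n : ℕ) (f : L.Functions n),
    IsLimitIn (T.opTop n) (T.ops n) (𝔘.op f) fun x => 𝔐.funMap f x) ∧
  ∀ (n : ℕ) (R : L.Relations n),
    IsLimitIn (T.relTop n) (T.rels n) (𝔘.rel R) {x | 𝔐.RelMap R x}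

/-- `g` is a homomorphism of ordinary models. -/
def IsModelHom {L : FirstOrder.Language.{w, w'}} {Z : Type u} {Y : Type v} (𝔐 : L.Structure Z)
    (𝔑 : L.Structure Y) (g : Z → Y) : Prop :=
  ∃ φ : @FirstOrder.Language.Hom L Z Y 𝔐 𝔑, φ.toFun = g

/-- `g` is a homomorphism of generalized models in the wide sense: a homomorphism of `lim 𝔘` into
`lim 𝔙`.  (Limits are unique.) -/
def IsWideHom {L : FirstOrder.Language.{w, w'}} {Z : Type u} {Y : Type v} (S : LimitSpaces Z)
    (𝔘 : WideModel L Z) (T : LimitSpaces Y) (𝔙 : WideModel L Y) (g : Z → Y) : Prop :=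
  ∃ (𝔐 : L.Structure Z) (𝔑 : L.Structure Y), 𝔘.IsLimit S 𝔐 ∧ 𝔙.IsLimit T 𝔑 ∧ IsModelHom 𝔐 𝔑 g

/-- The limit spaces used for ordinary models: all operations and all relations, discrete. -/
def LimitSpaces.discrete (Z : Type u) : LimitSpaces Z where
  opTop _ := ⊥
  relTop _ := ⊥
  ops _ := Set.univ
  rels _ := Set.univ

/-- The limit of an ordinary model, regarded as a generalized one, is the model itself. -/
theorem WideModel.ofModel_isLimit_iff {L : FirstOrder.Language.{w, w'}} {Z : Type u} (𝔄 𝔐 : L.Structure Z) :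
    (WideModel.ofModel 𝔄).IsLimit (LimitSpaces.discrete Z) 𝔐 ↔ 𝔐 = 𝔄 := by
  have key : ∀ {α : Type u} (a b : α),
      IsLimitIn (⊥ : TopologicalSpace α) Set.univ (pure a) b ↔ b = a := by
    intro α a b
    let _ : TopologicalSpace α := ⊥
    have _ : DiscreteTopology α := ⟨rfl⟩
    have e : ∀ c : α, ((pure a : Ultrafilter α) : Filter α) ≤ @nhds α ⊥ c ↔ a = c := by
      intro c
      rw [nhds_discrete, Ultrafilter.coe_pure, Filter.pure_le_iff]
      exact ⟨fun h => h {c} (Filter.mem_pure.2 rfl), fun h s hs => h ▸ hs⟩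
    constructor
    · rintro ⟨-, h, -⟩
      exact ((e b).1 h).symm
    · rintro rfl
      exact ⟨trivial, (e b).2 rfl, fun c _ hc => ((e c).1 hc).symm⟩
  constructor
  · rintro ⟨h₁, h₂⟩
    obtain ⟨F, R⟩ := 𝔐
    obtain ⟨F', R'⟩ := 𝔄
    congr 1
    · funext n f
      exact (key _ _).1 (h₁ n f)
    · funext n r x
      exact congrArg (fun A : Set (Fin n → Z) => x ∈ A) ((key _ _).1 (h₂ n r))
  · rintro rfl
    exact ⟨fun n f => (key _ _).2 rfl, fun n r => (key _ _).2 rfl⟩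

/-! ### Right topological notions and the pointwise convergence topology -/

section Right

variable {Z : Type u} [TopologicalSpace Z]

/-- The set of `n`-ary operations on `Z` that are right continuous w.r.t. `D`. -/
def rightContinuousOps (D : Set Z) (n : ℕ) : Set ((Fin n → Z) → Z) :=
  {F | ∀ (i : Fin n) (x : Fin n → Z), (∀ j < i, x j ∈ D) →
    Continuous fun z : Z => F (Function.update x i z)}

/-- The set of `n`-ary relations on `Z` that are right closed w.r.t. `D`. -/
def rightClosedRels (D : Set Z) (n : ℕ) : Set (Set (Fin n → Z)) :=
  {R | ∀ (i : Fin n) (x : Fin n → Z), (∀ j < i, x j ∈ D) →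
    IsClosed {z : Z | Function.update x i z ∈ R}}

/-- The set of `n`-ary relations on `Z` that are right clopen w.r.t. `D`. -/
def rightClopenRels (D : Set Z) (n : ℕ) : Set (Set (Fin n → Z)) :=
  {R | ∀ (i : Fin n) (x : Fin n → Z), (∀ j < i, x j ∈ D) →
    IsClopen {z : Z | Function.update x i z ∈ R}}

/-- The `D`-pointwise convergence topology on the set of `n`-ary operations on `Z`. -/
@[reducible]
def pointwiseOpTop (D : Set Z) (n : ℕ) : TopologicalSpace ((Fin n → Z) → Z) :=
  TopologicalSpace.generateFrom
    {O | ∃ (a : Fin n → Z) (B : Set Z), (∀ k, a k ∈ D) ∧ IsOpen B ∧ O = {F | F a ∈ B}}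

end Right

/-- The `D`-pointwise convergence topology on the set of `n`-ary relations on `Z`, identified with
their characteristic functions into the discrete two-point space. -/
@[reducible]
def pointwiseRelTop {Z : Type u} (D : Set Z) (n : ℕ) : TopologicalSpace (Set (Fin n → Z)) :=
  TopologicalSpace.generateFrom
    {O | ∃ a : Fin n → Z, (∀ k, a k ∈ D) ∧ (O = {R | a ∈ R} ∨ O = {R | a ∉ R})}

/-- The limit spaces used for the images of models in the narrow sense: right continuous operations
and right clopen relations w.r.t. the set of principal ultrafilters, with the topologies of pointwise
convergence on principal ultrafilters. -/
def LimitSpaces.ultrafilter (X : Type u) : LimitSpaces (Ultrafilter X) where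
  opTop := pointwiseOpTop (Set.range pure)
  relTop := pointwiseRelTop (Set.range pure)
  ops := rightContinuousOps (Set.range pure)
  rels := rightClopenRels (Set.range pure)

/-- The limit spaces consisting of right continuous operations and right closed relations w.r.t. `D`,
with given topologies on the sets of all operations and relations. -/
def LimitSpaces.right {Y : Type v} [TopologicalSpace Y] (D : Set Y)
    (τ : (n : ℕ) → TopologicalSpace ((Fin n → Y) → Y))
    (ρ : (n : ℕ) → TopologicalSpace (Set (Fin n → Y))) : LimitSpaces Y where
  opTop := τ
  relTop := ρ
  ops := rightContinuousOps D
  rels := rightClosedRels D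

end UltraModel

open UltraModel

/-!
A relation on ultrafilters that is right closed with respect to the principal ultrafilters contains
`tildeRel R` as soon as it contains the principal tuples of `R`: an ultrafilter is the limit of the
principal ultrafilters along itself, so the arguments of a tuple can be moved from principal to
arbitrary ultrafilters one at a time, the first argument last.  Applied to the graph of an equality,
this shows that `tildeOp F` and `tildeRel R` are the only right continuous, resp. right clopen,
extensions of `F` and `R`.  Since convergence to a model on ultrafilters only concerns principal
arguments, the limit of `i(𝔅)` is the extension `tildeModel` of the principal submodel.

Applied to the inverse image under a continuous `g` of a right closed relation, it shows that `g` is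
a homomorphism on the extension once it is one on principal ultrafilters.  For `starModel`, right
closed relations are replaced by closed ones, `starRel R` being the closure of `R`.
-/

open Filter Set Topology

namespace UltraModel

section RightTopology

variable {Z : Type u} {n : ℕ}

theorem forall_update_mem_succ_iff {D : Set Z} {R : Set (Fin (n + 1) → Z)} {P : Set Z → Prop} :
    (∀ (i : Fin (n + 1)) (x : Fin (n + 1) → Z), (∀ j < i, x j ∈ D) →
      P {z | Function.update x i z ∈ R}) ↔
    (∀ x : Fin (n + 1) → Z, P {z | Fin.cons z (Fin.tail x) ∈ R}) ∧
      ∀ a ∈ D, ∀ (i : Fin n) (y : Fin n → Z), (∀ j < i, y j ∈ D) →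
        P {z | Function.update y i z ∈ Fin.cons a ⁻¹' R} := by
  simp only [Fin.forall_fin_succ_pi, Fin.forall_fin_succ, Fin.update_cons_zero, ← Fin.cons_update,
    Fin.cons_zero, Fin.cons_succ, Fin.tail_cons, Fin.succ_lt_succ_iff, Fin.succ_pos,
    Fin.not_lt_zero, lt_irrefl, mem_preimage, forall_const, IsEmpty.forall_iff, implies_true,
    and_imp]
  tauto

theorem tendsto_pointwiseRelTop_iff {D : Set Z} {α : Type*} {l : Filter α}
    {R : α → Set (Fin n → Z)} {S : Set (Fin n → Z)} :
    Tendsto R l (@nhds _ (pointwiseRelTop D n) S) ↔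
      ∀ a : Fin n → Z, (∀ k, a k ∈ D) → ∀ᶠ i in l, (a ∈ R i ↔ a ∈ S) := by
  rw [TopologicalSpace.tendsto_nhds_generateFrom_iff]
  constructor
  · intro H a ha
    by_cases haS : a ∈ S
    · filter_upwards [H _ ⟨a, ha, .inl rfl⟩ haS] with i hi using iff_of_true hi haS
    · filter_upwards [H _ ⟨a, ha, .inr rfl⟩ haS] with i hi using iff_of_false hi haS
  · rintro H _ ⟨a, ha, rfl | rfl⟩ haS
    · filter_upwards [H a ha] with i hi using hi.2 haS
    · filter_upwards [H a ha] with i hi using mt hi.1 haS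

variable [TopologicalSpace Z] {Y : Type v} [TopologicalSpace Y] {D : Set Z} {E : Set Y}

theorem preimage_comp_mem_rightClosedRels {g : Z → Y} (hg : Continuous g) (hDE : MapsTo g D E)
    {S : Set (Fin n → Y)} (hS : S ∈ rightClosedRels E n) :
    (g ∘ ·) ⁻¹' S ∈ rightClosedRels D n := by
  intro i x hx
  simp only [mem_preimage, Function.comp_update]
  exact (hS i (g ∘ x) fun j hj => hDE (hx j hj)).preimage hg

theorem setOf_apply_eq_mem_rightClosedRels [T2Space Y] {g : Z → Y} (hg : Continuous g)
    (hDE : MapsTo g D E) {F : (Fin n → Z) → Z} (hF : F ∈ rightContinuousOps D n)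
    {G : (Fin n → Y) → Y} (hG : G ∈ rightContinuousOps E n) :
    {x | g (F x) = G (g ∘ x)} ∈ rightClosedRels D n := by
  intro i x hx
  simp only [mem_ofPred_eq, Function.comp_update]
  exact isClosed_eq (hg.comp (hF i x hx)) ((hG i (g ∘ x) fun j hj => hDE (hx j hj)).comp hg)

theorem mem_rightClosedRels_of_isClosed {S : Set (Fin n → Z)} (hS : IsClosed S) (D : Set Z) :
    S ∈ rightClosedRels D n :=
  fun i _ _ => hS.preimage (continuous_const.update i continuous_id)

theorem rightClopenRels_subset_rightClosedRels (D : Set Z) (n : ℕ) :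
    rightClopenRels D n ⊆ rightClosedRels D n :=
  fun _ hR i x hx => (hR i x hx).isClosed

theorem compl_mem_rightClopenRels {R : Set (Fin n → Z)} (hR : R ∈ rightClopenRels D n) :
    Rᶜ ∈ rightClopenRels D n :=
  fun i x hx => (hR i x hx).compl

theorem tendsto_pointwiseOpTop_iff {α : Type*} {l : Filter α} {F : α → (Fin n → Z) → Z}
    {G : (Fin n → Z) → Z} :
    Tendsto F l (@nhds _ (pointwiseOpTop D n) G) ↔
      ∀ a : Fin n → Z, (∀ k, a k ∈ D) → Tendsto (F · a) l (𝓝 (G a)) := by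
  rw [TopologicalSpace.tendsto_nhds_generateFrom_iff]
  constructor
  · intro H a ha
    exact tendsto_nhds.2 fun B hB hGB => H _ ⟨a, B, ha, hB, rfl⟩ hGB
  · rintro H _ ⟨a, B, ha, hB, rfl⟩ hGB
    exact H a ha (hB.mem_nhds hGB)

end RightTopology

section Extensions

variable {X : Type u} {n : ℕ}

theorem cons_mem_tildeRel_iff {R : Set (Fin (n + 1) → X)} {p : Ultrafilter X}
    {u : Fin n → Ultrafilter X} :
    (Fin.cons p u : Fin (n + 1) → Ultrafilter X) ∈ tildeRel R ↔
      ∀ᶠ x in (p : Filter X), u ∈ tildeRel (Fin.cons (α := fun _ => X) x ⁻¹' R) :=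
  Iff.rfl

theorem compl_tildeRel (R : Set (Fin n → X)) : (tildeRel R)ᶜ = tildeRel Rᶜ :=
  Set.ext fun _ => Ultrafilter.compl_mem_iff_notMem.symm

theorem pure_comp_mem_tildeRel_iff {R : Set (Fin n → X)} {a : Fin n → X} :
    pure ∘ a ∈ tildeRel R ↔ a ∈ R := by
  induction n with
  | zero => rw [Subsingleton.elim a Fin.elim0]; rfl
  | succ n ih =>
    induction a using Fin.consCases with
    | cons x a =>
      rw [Fin.comp_cons, cons_mem_tildeRel_iff, Ultrafilter.coe_pure, eventually_pure, ih]
      rfl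

theorem tensor_pure_comp (a : Fin n → X) : tensor (pure ∘ a) = pure a :=
  Ultrafilter.ext fun _ => pure_comp_mem_tildeRel_iff

theorem tildeOp_pure_comp (F : (Fin n → X) → X) (a : Fin n → X) :
    tildeOp F (pure ∘ a) = pure (F a) := by
  rw [tildeOp, tensor_pure_comp, Ultrafilter.map_pure]

theorem tildeRel_mem_rightClopenRels (R : Set (Fin n → X)) :
    tildeRel R ∈ rightClopenRels (range (pure : X → Ultrafilter X)) n := by
  induction n with
  | zero => exact fun i => i.elim0
  | succ n ih =>
    let fiber (x : X) : Set (Fin n → X) := Fin.cons (α := fun _ => X) x ⁻¹' R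
    refine forall_update_mem_succ_iff.2 ⟨fun u => ?_, ?_⟩
    · exact ⟨ultrafilter_isClosed_basic {x | Fin.tail u ∈ tildeRel (fiber x)},
        ultrafilter_isOpen_basic {x | Fin.tail u ∈ tildeRel (fiber x)}⟩
    · rintro _ ⟨x, rfl⟩
      exact ih (fiber x)

theorem tildeOp_mem_rightContinuousOps (F : (Fin n → X) → X) :
    tildeOp F ∈ rightContinuousOps (range (pure : X → Ultrafilter X)) n := by
  intro i u hu
  refine continuous_generateFrom_iff.2 ?_
  rintro _ ⟨A, rfl⟩
  exact (tildeRel_mem_rightClopenRels (F ⁻¹' A) i u hu).isOpen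

theorem tildeRel_subset_of_rightClosed {R : Set (Fin n → X)} {S : Set (Fin n → Ultrafilter X)}
    (hS : S ∈ rightClosedRels (range pure) n) (hRS : ∀ a ∈ R, pure ∘ a ∈ S) :
    tildeRel R ⊆ S := by
  induction n with
  | zero =>
    intro u hu
    rw [Subsingleton.elim u (pure ∘ Fin.elim0)]
    exact hRS _ hu
  | succ n ih =>
    obtain ⟨hS_head, hS_tail⟩ := forall_update_mem_succ_iff.1 hS
    intro u hu
    induction u using Fin.consCases with
    | cons p u =>
      have mem_of_pure : ∀ᶠ x in (p : Filter X), Fin.cons (pure x) u ∈ S := by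
        filter_upwards [cons_mem_tildeRel_iff.1 hu] with x hx
        refine ih (hS_tail _ ⟨x, rfl⟩) (fun a ha => ?_) hx
        rw [mem_preimage, ← Fin.comp_cons]
        exact hRS _ ha
      exact (hS_head (Fin.cons p u)).mem_of_tendsto p.tendsto_pure_self mem_of_pure

theorem tildeRel_eq_of_rightClopen {R : Set (Fin n → X)} {S : Set (Fin n → Ultrafilter X)}
    (hS : S ∈ rightClopenRels (range pure) n) (hRS : ∀ a, pure ∘ a ∈ S ↔ a ∈ R) :
    tildeRel R = S := by
  have of_rightClopen := rightClopenRels_subset_rightClosedRels (range (pure : X → Ultrafilter X)) n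
  refine (tildeRel_subset_of_rightClosed (of_rightClopen hS) fun a => (hRS a).2).antisymm ?_
  rw [← compl_subset_compl, compl_tildeRel]
  exact tildeRel_subset_of_rightClosed (of_rightClopen (compl_mem_rightClopenRels hS))
    fun a => mt (hRS a).1

theorem apply_tildeOp_of_rightContinuous {Y : Type v} [TopologicalSpace Y] [T2Space Y]
    {g : Ultrafilter X → Y} (hg : Continuous g) {F : (Fin n → X) → X} {G : (Fin n → Y) → Y}
    (hG : G ∈ rightContinuousOps (range (g ∘ pure)) n)
    (hFG : ∀ a, g (pure (F a)) = G (g ∘ pure ∘ a)) (u : Fin n → Ultrafilter X) :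
    g (tildeOp F u) = G (g ∘ u) := by
  refine tildeRel_subset_of_rightClosed (R := univ) (S := {u | g (tildeOp F u) = G (g ∘ u)})
    ?_ (fun a _ => ?_) (univ_mem : univ ∈ (tensor u : Filter (Fin n → X)))
  · refine setOf_apply_eq_mem_rightClosedRels hg ?_ (tildeOp_mem_rightContinuousOps F) hG
    exact range_comp g pure ▸ mapsTo_image g (range pure)
  · rw [mem_ofPred_eq, tildeOp_pure_comp, hFG]

theorem tildeOp_eq_of_rightContinuous {F : (Fin n → X) → X}
    {G : (Fin n → Ultrafilter X) → Ultrafilter X} (hG : G ∈ rightContinuousOps (range pure) n)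
    (hFG : ∀ a, pure (F a) = G (pure ∘ a)) : tildeOp F = G :=
  funext (apply_tildeOp_of_rightContinuous continuous_id hG hFG)

theorem starRel_eq_closure (R : Set (Fin n → X)) : starRel R = closure ((pure ∘ ·) '' R) := by
  ext u
  rw [mem_closure_iff]
  constructor
  · intro hu O hO huO
    obtain ⟨U, hU, hUO⟩ := isOpen_pi_iff'.1 hO u huO
    obtain ⟨a, haU, haR⟩ := hu (fun k => pure ⁻¹' U k) fun k =>
      (u k).tendsto_pure_self ((hU k).1.mem_nhds (hU k).2)
    exact ⟨pure ∘ a, hUO fun k _ => haU k, a, haR, rfl⟩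
  · intro hu A hA
    obtain ⟨_, haA, a, haR, rfl⟩ := hu (univ.pi fun k => {v | A k ∈ v})
      (isOpen_set_pi finite_univ fun k _ => ultrafilter_isOpen_basic (A k)) fun k _ => hA k
    exact ⟨a, fun k => haA k (mem_univ k), haR⟩

end Extensions

section Limits

variable {L : FirstOrder.Language.{w, w'}}

theorem IsLimitIn.eq_of_subset {α : Type u} {t : TopologicalSpace α} {C C' : Set α}
    {𝔲 : Ultrafilter α} {a a' : α} (ha : IsLimitIn t C 𝔲 a) (ha' : IsLimitIn t C' 𝔲 a')
    (hC : C' ⊆ C) : a' = a :=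
  ha.2.2 a' (hC ha'.1) ha'.2.1

theorem WideModel.IsLimit.unique {Z : Type u} {𝔘 : WideModel L Z} {T : LimitSpaces Z}
    {𝔐 𝔑 : L.Structure Z} (h𝔐 : 𝔘.IsLimit T 𝔐) (h𝔑 : 𝔘.IsLimit T 𝔑) : 𝔐 = 𝔑 := by
  refine FirstOrder.Language.Structure.ext ?_ ?_
  · funext n f
    exact (h𝔑.1 n f).eq_of_subset (h𝔐.1 n f) Subset.rfl
  · funext n R
    exact (h𝔑.2 n R).eq_of_subset (h𝔐.2 n R) Subset.rfl

theorem isWideHom_congr {Z : Type u} {Z' : Type*} {Y : Type v} {S : LimitSpaces Z}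
    {S' : LimitSpaces Z'} {𝔘 : WideModel L Z} {𝔘' : WideModel L Z'} {T : LimitSpaces Y}
    {𝔙 : WideModel L Y} {𝔐 : L.Structure Z} {𝔐' : L.Structure Z'} {g : Z → Y} {g' : Z' → Y}
    (h𝔐 : 𝔘.IsLimit S 𝔐) (h𝔐' : 𝔘'.IsLimit S' 𝔐')
    (hom_iff : ∀ 𝔑, 𝔙.IsLimit T 𝔑 → (IsModelHom 𝔐 𝔑 g ↔ IsModelHom 𝔐' 𝔑 g')) :
    IsWideHom S 𝔘 T 𝔙 g ↔ IsWideHom S' 𝔘' T 𝔙 g' := by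
  constructor
  · rintro ⟨𝔐₁, 𝔑, h𝔐₁, h𝔑, hg⟩
    obtain rfl := h𝔐₁.unique h𝔐
    exact ⟨𝔐', 𝔑, h𝔐', h𝔑, (hom_iff 𝔑 h𝔑).1 hg⟩
  · rintro ⟨𝔐₁, 𝔑, h𝔐₁, h𝔑, hg⟩
    obtain rfl := h𝔐₁.unique h𝔐'
    exact ⟨𝔐, 𝔑, h𝔐, h𝔑, (hom_iff 𝔑 h𝔑).2 hg⟩

variable {X : Type u} {n : ℕ}

theorem tendsto_pure_comp_iff_map_eq {α : Type*} {𝔲 : Ultrafilter α} {f : α → X}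
    {p : Ultrafilter X} : Tendsto (fun i => pure (f i)) 𝔲 (𝓝 p) ↔ 𝔲.map f = p := by
  have tendsto_map : Tendsto (fun i => (pure (f i) : Ultrafilter X)) 𝔲 (𝓝 (𝔲.map f)) :=
    (𝔲.map f).tendsto_pure_self
  exact ⟨tendsto_nhds_unique tendsto_map, fun h => h ▸ tendsto_map⟩

theorem exists_pure_comp_eq {a : Fin n → Ultrafilter X} (ha : ∀ k, a k ∈ range pure) :
    ∃ b : Fin n → X, a = pure ∘ b :=
  range_subset_range_iff_exists_comp.1 (range_subset_iff.2 ha)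

theorem tendsto_tildeOp_iff {𝔣 : Ultrafilter ((Fin n → X) → X)}
    {G : (Fin n → Ultrafilter X) → Ultrafilter X} :
    Tendsto tildeOp 𝔣 (@nhds _ (pointwiseOpTop (range pure) n) G) ↔
      ∀ a : Fin n → X, 𝔣.map (· a) = G (pure ∘ a) := by
  simp only [tendsto_pointwiseOpTop_iff, ← tendsto_pure_comp_iff_map_eq, ← tildeOp_pure_comp]
  refine ⟨fun H a => H _ fun k => mem_range_self (a k), fun H a ha => ?_⟩
  obtain ⟨b, rfl⟩ := exists_pure_comp_eq ha
  exact H b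

theorem tendsto_tildeRel_iff {𝔯 : Ultrafilter (Set (Fin n → X))}
    {S : Set (Fin n → Ultrafilter X)} :
    Tendsto tildeRel 𝔯 (@nhds _ (pointwiseRelTop (range pure) n) S) ↔
      ∀ a : Fin n → X, pure ∘ a ∈ S ↔ ∀ᶠ R in (𝔯 : Filter (Set (Fin n → X))), a ∈ R := by
  have eventually_iff (a : Fin n → X) :
      (∀ᶠ R in (𝔯 : Filter (Set (Fin n → X))), (pure ∘ a ∈ tildeRel R ↔ pure ∘ a ∈ S)) ↔
        (pure ∘ a ∈ S ↔ ∀ᶠ R in (𝔯 : Filter (Set (Fin n → X))), a ∈ R) := by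
    by_cases ha : pure ∘ a ∈ S <;>
      simp only [ha, pure_comp_mem_tildeRel_iff, iff_true, true_iff, iff_false, false_iff,
        Ultrafilter.eventually_not]
  rw [tendsto_pointwiseRelTop_iff]
  refine ⟨fun H a => (eventually_iff a).1 (H _ fun k => mem_range_self (a k)), fun H a ha => ?_⟩
  obtain ⟨b, rfl⟩ := exists_pure_comp_eq ha
  exact (eventually_iff b).2 (H b)

theorem isLimitIn_map_tildeOp {𝔣 : Ultrafilter ((Fin n → X) → X)} {F : (Fin n → X) → X}
    (hF : ∀ a, 𝔣.map (· a) = pure (F a)) :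
    IsLimitIn (pointwiseOpTop (range pure) n) (rightContinuousOps (range pure) n)
      (𝔣.map tildeOp) (tildeOp F) := by
  refine ⟨tildeOp_mem_rightContinuousOps F, ?_, fun G hG h𝔣G => ?_⟩
  · exact tendsto_tildeOp_iff.2 fun a => (hF a).trans (tildeOp_pure_comp F a).symm
  · refine (tildeOp_eq_of_rightContinuous hG fun a => ?_).symm
    rw [← hF, tendsto_tildeOp_iff.1 h𝔣G]

theorem isLimitIn_map_tildeRel (𝔯 : Ultrafilter (Set (Fin n → X))) :
    IsLimitIn (pointwiseRelTop (range pure) n) (rightClopenRels (range pure) n)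
      (𝔯.map tildeRel) (tildeRel {a | ∀ᶠ R in (𝔯 : Filter (Set (Fin n → X))), a ∈ R}) := by
  refine ⟨tildeRel_mem_rightClopenRels _, ?_, fun S hS h𝔯S => ?_⟩
  · exact tendsto_tildeRel_iff.2 fun a => pure_comp_mem_tildeRel_iff
  · exact (tildeRel_eq_of_rightClopen hS (tendsto_tildeRel_iff.1 h𝔯S)).symm

theorem appTilde_pure_comp (a : Fin n → X) (𝔣 : Ultrafilter ((Fin n → X) → X)) :
    appTilde (pure ∘ a) 𝔣 = 𝔣.map (· a) := by
  rw [appTilde, tensor_pure_comp]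
  rfl

theorem inTilde_pure_comp_iff {a : Fin n → X} {𝔯 : Ultrafilter (Set (Fin n → X))} :
    inTilde (pure ∘ a) 𝔯 ↔ ∀ᶠ R in (𝔯 : Filter (Set (Fin n → X))), a ∈ R := by
  rw [inTilde, tensor_pure_comp, Ultrafilter.coe_pure, eventually_pure]

theorem NarrowModel.isLimit_toWide (𝔅 : NarrowModel L X) (h𝔅 : 𝔅.PseudoPrincipal) :
    𝔅.toWide.IsLimit (LimitSpaces.ultrafilter X) (tildeModel (𝔅.principalSubmodel h𝔅)) := by
  refine ⟨fun n f => isLimitIn_map_tildeOp fun a => ?_, fun n R => ?_⟩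
  · rw [𝔅.pure_funMap_principalSubmodel h𝔅]
    exact (appTilde_pure_comp a _).symm
  · have relMap_eq : {a | (𝔅.principalSubmodel h𝔅).RelMap R a} =
        {a | ∀ᶠ S in (𝔅.rel R : Filter (Set (Fin n → X))), a ∈ S} :=
      Set.ext fun a => inTilde_pure_comp_iff
    change IsLimitIn _ _ _ (tildeRel {a | (𝔅.principalSubmodel h𝔅).RelMap R a})
    exact relMap_eq ▸ isLimitIn_map_tildeRel (𝔅.rel R)

end Limits

section Homomorphisms

variable {L : FirstOrder.Language.{w, w'}}

theorem isModelHom_iff {Z : Type u} {Y : Type v} {𝔐 : L.Structure Z} {𝔑 : L.Structure Y}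
    {g : Z → Y} : IsModelHom 𝔐 𝔑 g ↔
      (∀ (n : ℕ) (f : L.Functions n) (x : Fin n → Z), g (𝔐.funMap f x) = 𝔑.funMap f (g ∘ x)) ∧
      ∀ (n : ℕ) (R : L.Relations n) (x : Fin n → Z), 𝔐.RelMap R x → 𝔑.RelMap R (g ∘ x) := by
  constructor
  · rintro ⟨φ, rfl⟩
    exact ⟨fun _ => φ.map_fun', fun _ => φ.map_rel'⟩
  · rintro ⟨map_fun, map_rel⟩
    exact ⟨@FirstOrder.Language.Hom.mk L Z Y 𝔐 𝔑 g (map_fun _) (map_rel _), rfl⟩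

theorem IsModelHom.comp {Z₁ Z₂ Z₃ : Type*} {𝔐₁ : L.Structure Z₁} {𝔐₂ : L.Structure Z₂}
    {𝔐₃ : L.Structure Z₃} {g : Z₂ → Z₃} {f : Z₁ → Z₂} (hg : IsModelHom 𝔐₂ 𝔐₃ g)
    (hf : IsModelHom 𝔐₁ 𝔐₂ f) : IsModelHom 𝔐₁ 𝔐₃ (g ∘ f) := by
  obtain ⟨γ, rfl⟩ := hg
  obtain ⟨φ, rfl⟩ := hf
  exact ⟨γ.comp φ, rfl⟩

variable {X : Type u} (𝔄 : L.Structure X)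

theorem isModelHom_pure_tildeModel : IsModelHom 𝔄 (tildeModel 𝔄) pure :=
  isModelHom_iff.2 ⟨fun _ _ a => (tildeOp_pure_comp _ a).symm,
    fun _ _ _ => pure_comp_mem_tildeRel_iff.2⟩

theorem isModelHom_pure_starModel : IsModelHom 𝔄 (starModel 𝔄) pure :=
  isModelHom_iff.2 ⟨fun _ _ a => (tildeOp_pure_comp _ a).symm,
    fun _ _ a ha => (starRel_eq_closure _).ge (subset_closure ⟨a, ha, rfl⟩)⟩

variable {𝔄} {Y : Type v} [TopologicalSpace Y] [T2Space Y] {𝔑 : L.Structure Y}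
  {g : Ultrafilter X → Y}

theorem isModelHom_tildeModel_iff (hg : Continuous g)
    (hop : ∀ (n : ℕ) (f : L.Functions n),
      (fun y => 𝔑.funMap f y) ∈ rightContinuousOps (range (g ∘ pure)) n)
    (hrel : ∀ (n : ℕ) (R : L.Relations n),
      {y | 𝔑.RelMap R y} ∈ rightClosedRels (range (g ∘ pure)) n) :
    IsModelHom (tildeModel 𝔄) 𝔑 g ↔ IsModelHom 𝔄 𝔑 (g ∘ pure) := by
  refine ⟨fun H => H.comp (isModelHom_pure_tildeModel 𝔄), fun H => ?_⟩
  obtain ⟨map_fun, map_rel⟩ := isModelHom_iff.1 H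
  have hmaps : MapsTo g (range pure) (range (g ∘ pure)) :=
    range_comp g pure ▸ mapsTo_image g (range pure)
  exact isModelHom_iff.2
    ⟨fun n f => apply_tildeOp_of_rightContinuous hg (hop n f) (map_fun n f),
      fun n R _ hu => tildeRel_subset_of_rightClosed
        (preimage_comp_mem_rightClosedRels hg hmaps (hrel n R)) (map_rel n R) hu⟩

theorem isModelHom_starModel_iff (hg : Continuous g)
    (hop : ∀ (n : ℕ) (f : L.Functions n),
      (fun y => 𝔑.funMap f y) ∈ rightContinuousOps (range (g ∘ pure)) n)
    (hrel : ∀ (n : ℕ) (R : L.Relations n), IsClosed {y | 𝔑.RelMap R y}) :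
    IsModelHom (starModel 𝔄) 𝔑 g ↔ IsModelHom 𝔄 𝔑 (g ∘ pure) := by
  refine ⟨fun H => H.comp (isModelHom_pure_starModel 𝔄), fun H => ?_⟩
  obtain ⟨map_fun, map_rel⟩ := isModelHom_iff.1 H
  refine isModelHom_iff.2
    ⟨fun n f => apply_tildeOp_of_rightContinuous hg (hop n f) (map_fun n f), fun n R u hu => ?_⟩
  have closed_preimage : IsClosed ((g ∘ ·) ⁻¹' {y | 𝔑.RelMap R y} : Set (Fin n → _)) :=
    (hrel n R).preimage (by fun_prop)
  have image_subset : (pure ∘ ·) '' {a | 𝔄.RelMap R a} ⊆ (g ∘ ·) ⁻¹' {y | 𝔑.RelMap R y} :=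
    image_subset_iff.2 (map_rel n R)
  exact closure_minimal image_subset closed_preimage ((starRel_eq_closure _).le hu)

end Homomorphisms

end UltraModel

theorem mainTheorem1_general {L : FirstOrder.Language.{w, w'}} {X : Type u} {Y : Type v}
    [TopologicalSpace Y] [T2Space Y] (𝔅 : NarrowModel L X) (h𝔅 : 𝔅.PseudoPrincipal)
    (𝔙 : WideModel L Y)
    (τ : (n : ℕ) → TopologicalSpace ((Fin n → Y) → Y))
    (ρ : (n : ℕ) → TopologicalSpace (Set (Fin n → Y)))
    {g : Ultrafilter X → Y} (hg : Continuous g) :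
    [IsWideHom (LimitSpaces.discrete X) (WideModel.ofModel (𝔅.principalSubmodel h𝔅))
        (LimitSpaces.right (range (g ∘ pure)) τ ρ) 𝔙 (g ∘ pure),
      IsWideHom (LimitSpaces.ultrafilter X) 𝔅.toWide
        (LimitSpaces.right (range (g ∘ pure)) τ ρ) 𝔙 g,
      IsWideHom (LimitSpaces.discrete (Ultrafilter X))
        (WideModel.ofModel (tildeModel (𝔅.principalSubmodel h𝔅)))
        (LimitSpaces.right (range (g ∘ pure)) τ ρ) 𝔙 g].TFAE ∧
    ((∀ (n : ℕ) (R : L.Relations n),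
        ∃ S, IsLimitIn (ρ n) {S : Set (Fin n → Y) | IsClosed S} (𝔙.rel R) S) →
      [IsWideHom (LimitSpaces.discrete X) (WideModel.ofModel (𝔅.principalSubmodel h𝔅))
          (LimitSpaces.right (range (g ∘ pure)) τ ρ) 𝔙 (g ∘ pure),
        IsWideHom (LimitSpaces.ultrafilter X) 𝔅.toWide
          (LimitSpaces.right (range (g ∘ pure)) τ ρ) 𝔙 g,
        IsWideHom (LimitSpaces.discrete (Ultrafilter X))
          (WideModel.ofModel (tildeModel (𝔅.principalSubmodel h𝔅)))
          (LimitSpaces.right (range (g ∘ pure)) τ ρ) 𝔙 g,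
        IsWideHom (LimitSpaces.discrete (Ultrafilter X))
          (WideModel.ofModel (starModel (𝔅.principalSubmodel h𝔅)))
          (LimitSpaces.right (range (g ∘ pure)) τ ρ) 𝔙 g].TFAE) := by
  set T := LimitSpaces.right (range (g ∘ pure)) τ ρ
  set 𝔄 := 𝔅.principalSubmodel h𝔅
  have isLimit_ofModel {Z : Type u} (𝔐 : L.Structure Z) :=
    (WideModel.ofModel_isLimit_iff 𝔐 𝔐).2 rfl
  have principal_iff_tilde := isWideHom_congr (T := T) (𝔙 := 𝔙) (isLimit_ofModel 𝔄)
    (isLimit_ofModel (tildeModel 𝔄)) fun 𝔑 h𝔑 =>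
      (isModelHom_tildeModel_iff hg (fun n f => (h𝔑.1 n f).1) fun n R => (h𝔑.2 n R).1).symm
  have wide_iff_tilde := isWideHom_congr (T := T) (𝔙 := 𝔙) (g := g) (𝔅.isLimit_toWide h𝔅)
    (isLimit_ofModel (tildeModel 𝔄)) fun _ _ => Iff.rfl
  constructor
  · tfae_have 1 ↔ 3 := principal_iff_tilde
    tfae_have 2 ↔ 3 := wide_iff_tilde
    tfae_finish
  · intro hclosed
    have closed_rel (𝔑) (h𝔑 : 𝔙.IsLimit T 𝔑) (n) (R : L.Relations n) :
        IsClosed {y | 𝔑.RelMap R y} := by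
      obtain ⟨S, hS⟩ := hclosed n R
      exact (h𝔑.2 n R).eq_of_subset hS (fun _ h => mem_rightClosedRels_of_isClosed h _) ▸ hS.1
    have principal_iff_star := isWideHom_congr (T := T) (𝔙 := 𝔙) (isLimit_ofModel 𝔄)
      (isLimit_ofModel (starModel 𝔄)) fun 𝔑 h𝔑 =>
        (isModelHom_starModel_iff hg (fun n f => (h𝔑.1 n f).1) (closed_rel 𝔑 h𝔑)).symm
    tfae_have 1 ↔ 3 := principal_iff_tilde
    tfae_have 2 ↔ 3 := wide_iff_tilde
    tfae_have 1 ↔ 4 := principal_iff_star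
    tfae_finish

theorem mainTheorem1 {L : FirstOrder.Language.{w, w'}} {X : Type u} {Y : Type v}
    [TopologicalSpace Y] [CompactSpace Y] [T2Space Y]
    (𝔅 : NarrowModel L X) (h𝔅 : 𝔅.PseudoPrincipal)
    (𝔄 : L.Structure X) (h𝔄 : 𝔄 = 𝔅.principalSubmodel h𝔅)
    (𝔘 : WideModel L (Ultrafilter X)) (h𝔘 : 𝔘 = 𝔅.toWide)
    (𝔙 : WideModel L Y)
    (τ : (n : ℕ) → TopologicalSpace ((Fin n → Y) → Y))
    (ρ : (n : ℕ) → TopologicalSpace (Set (Fin n → Y)))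
    (h : X → Y)
    (hop : ∀ (n : ℕ) (f : L.Functions n),
      ∃ G, IsLimitIn (τ n) (rightContinuousOps (Set.range h) n) (𝔙.op f) G)
    (hrel : ∀ (n : ℕ) (R : L.Relations n),
      ∃ S, IsLimitIn (ρ n) (rightClosedRels (Set.range h) n) (𝔙.rel R) S) :
    [IsWideHom (LimitSpaces.discrete X) (WideModel.ofModel 𝔄)
        (LimitSpaces.right (Set.range h) τ ρ) 𝔙 h,
      IsWideHom (LimitSpaces.ultrafilter X) 𝔘
        (LimitSpaces.right (Set.range h) τ ρ) 𝔙 (Ultrafilter.extend h),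
      IsWideHom (LimitSpaces.discrete (Ultrafilter X)) (WideModel.ofModel (tildeModel 𝔄))
        (LimitSpaces.right (Set.range h) τ ρ) 𝔙 (Ultrafilter.extend h)].TFAE ∧
    ((∀ (n : ℕ) (R : L.Relations n),
        ∃ S, IsLimitIn (ρ n) {S : Set (Fin n → Y) | IsClosed S} (𝔙.rel R) S) →
      [IsWideHom (LimitSpaces.discrete X) (WideModel.ofModel 𝔄)
          (LimitSpaces.right (Set.range h) τ ρ) 𝔙 h,
        IsWideHom (LimitSpaces.ultrafilter X) 𝔘
          (LimitSpaces.right (Set.range h) τ ρ) 𝔙 (Ultrafilter.extend h),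
        IsWideHom (LimitSpaces.discrete (Ultrafilter X)) (WideModel.ofModel (tildeModel 𝔄))
          (LimitSpaces.right (Set.range h) τ ρ) 𝔙 (Ultrafilter.extend h),
        IsWideHom (LimitSpaces.discrete (Ultrafilter X)) (WideModel.ofModel (starModel 𝔄))
          (LimitSpaces.right (Set.range h) τ ρ) 𝔙 (Ultrafilter.extend h)].TFAE) := by
  subst h𝔄 h𝔘
  simpa only [ultrafilter_extend_extends] using
    mainTheorem1_general 𝔅 h𝔅 𝔙 τ ρ (continuous_ultrafilter_extend h)
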